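/- Proposition 2.3. Let $\psi_\omega:\mathbb{R}^n\to\mathbb{R}$ be strictly convex, and let $\psi_0,\psi_1:\mathbb{R}^n\to\mathbb{R}$ be convex functions such that $\psi_0-\psi_\omega$ and $\psi_1-\psi_\omega$ are bounded. (This is the situation on a compact toric Kähler manifold $(M,\omega)$: there $\psi_\omega$ is the Kähler potential of $\omega$ on the open orbit in the coordinates $x=\mathrm{Re}\log z\in\mathbb{R}^n$, and $\psi_i(x)=\psi_\omega(x)+v_i(e^x)$ with $v_i$ a bounded torus-invariant $\omega$-plurisubharmonic function.) Consider the homogeneous real Monge–Ampère equation $$\mathrm{MA}\,\psi=0\ \text{ on } [0,1]\times\mathbb{R}^n,\qquad \psi(0,\cdot)=\psi_0,\quad \psi(1,\cdot)=\psi_1 .$$ A solution is a function $\psi:[0,1]\times\mathbb{R}^n\to\mathbb{R}$, convex in all variables $(s,x)$, whose Monge–Ampère measure in the sense of Alexandrov, $B\mapsto \mathrm{Leb}(\partial\psi(B))$, vanishes on $(0,1)\times\mathbb{R}^n$, and such that for every $x$ the function $s\mapsto\psi(s,x)$ is continuous on $[0,1]$ with $\psi(0,x)=\psi_0(x)$ and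 $\psi(1,x)=\psi_1(x)$. Then a solution $\psi$ with $\psi(s,x)-\psi_\omega(x)$ bounded on $[0,1]\times\mathbb{R}^n$ exists, and every solution is given by $$\psi(s,x)=\sup_{\sigma\in\mathbb{R}}\Big[\min\{\psi_0,\psi_1-\sigma\}^{\star\star}(x)+s\sigma\Big],\qquad (s,x)\in[0,1]\times\mathbb{R}^n$$ (in particular the solution is unique). Here $f^{\star}(y)=\sup_{x\in\mathbb{R}^n}[\langle x,y\rangle-f(x)]\in[-\infty,\infty]$ is the Legendre transform in the $\mathbb{R}^n$ variables, so that $f^{\star\star}$ is the convexification of $f$ in $x$. -/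

import Mathlib

open Set MeasureTheory

noncomputable section

/-- The closed strip `[0,1] × ℝⁿ`, with variables `(s, x)`. -/
def closedStrip (n : ℕ) : Set (ℝ × EuclideanSpace ℝ (Fin n)) :=
  Icc (0 : ℝ) 1 ×ˢ univ

/-- The open strip `(0,1) × ℝⁿ`. -/
def openStrip (n : ℕ) : Set (ℝ × EuclideanSpace ℝ (Fin n)) :=
  Ioo (0 : ℝ) 1 ×ˢ univ

/-- The subdifferential at `p = (s, x)` of a function `u` on a set `Ω ⊆ ℝ × ℝⁿ`: all slopes
`q = (τ, y)` such that the affine function of slope `q` which agrees with `u` at `p` lies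
below `u` on all of `Ω`. -/
def subdifferentialOn {n : ℕ} (Ω : Set (ℝ × EuclideanSpace ℝ (Fin n)))
    (u : ℝ × EuclideanSpace ℝ (Fin n) → ℝ) (p : ℝ × EuclideanSpace ℝ (Fin n)) :
    Set (ℝ × EuclideanSpace ℝ (Fin n)) :=
  {q | ∀ p' ∈ Ω, u p + q.1 * (p'.1 - p.1) + inner ℝ q.2 (p'.2 - p.2) ≤ u p'}

/-- The real Monge–Ampère mass of a Borel set `B ⊆ Ω`, for a convex function `u` on an open convex
set `Ω ⊆ ℝ × ℝⁿ`, in the sense of Alexandrov: the Lebesgue measure of the set of all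
subgradients of `u` at points of `B`. For `u` of class `C²` this is `∫_B det D²u`, and it is the
continuous extension of the latter to all convex functions. -/
def mongeAmpere {n : ℕ} (Ω : Set (ℝ × EuclideanSpace ℝ (Fin n)))
    (u : ℝ × EuclideanSpace ℝ (Fin n) → ℝ) (B : Set (ℝ × EuclideanSpace ℝ (Fin n))) : ENNReal :=
  volume (⋃ p ∈ B, subdifferentialOn Ω u p)

/-- `ψ` is a (weak) solution of the homogeneous real Monge–Ampère equation on `[0,1] × ℝⁿ`
with endpoints `ψ₀` and `ψ₁`: it is convex in all variables, its Monge–Ampère measure vanishes in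
the open strip, and for each `x` the function `ψ(·, x)` is continuous up to the
boundary of `[0,1]` with boundary values `ψ₀ x` and `ψ₁ x`. -/
structure IsHRMASolution {n : ℕ} (ψ₀ ψ₁ : EuclideanSpace ℝ (Fin n) → ℝ)
    (ψ : ℝ × EuclideanSpace ℝ (Fin n) → ℝ) : Prop where
  convexOn : ConvexOn ℝ (closedStrip n) ψ
  mongeAmpere_eq_zero : ∀ B : Set (ℝ × EuclideanSpace ℝ (Fin n)), MeasurableSet B →
    B ⊆ openStrip n → mongeAmpere (openStrip n) ψ B = 0
  continuousOn : ∀ x, ContinuousOn (fun s : ℝ => ψ (s, x)) (Icc 0 1)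
  left_endpoint : ∀ x, ψ (0, x) = ψ₀ x
  right_endpoint : ∀ x, ψ (1, x) = ψ₁ x

/-- The Legendre transform in the `ℝⁿ` variables, `f⋆(y) = sup_x [⟨x, y⟩ - f(x)]`, with values
in `[-∞, ∞]`. -/
def legendre {n : ℕ} (f : EuclideanSpace ℝ (Fin n) → EReal) (y : EuclideanSpace ℝ (Fin n)) :
    EReal :=
  ⨆ x : EuclideanSpace ℝ (Fin n), ((inner ℝ x y : ℝ) : EReal) - f x

/-- The rooftop envelope `min{ψ₀, ψ₁ - σ}⋆⋆`: the convexification in `x`, by a double Legendre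
transform. -/
def rooftopEnvelope {n : ℕ} (ψ₀ ψ₁ : EuclideanSpace ℝ (Fin n) → ℝ) (σ : ℝ) :
    EuclideanSpace ℝ (Fin n) → EReal :=
  legendre (legendre fun x => ((min (ψ₀ x) (ψ₁ x - σ) : ℝ) : EReal))

/-- The negative Legendre transform in the variable dual to `s`,
`g⋆(s) = sup_σ [g(σ) + s σ]`, with values in `[-∞, ∞]`. -/
def negLegendre (g : ℝ → EReal) (s : ℝ) : EReal :=
  ⨆ σ : ℝ, g σ + ((s * σ : ℝ) : EReal)

end

/-! Every solution is the supremum of the affine functions of `(s, x)` that lie below the data at `s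
= 0` and `s = 1`. A convex function with these boundary values is attained at each point by such a
minorant: a supporting plane inside the strip, a tilted subgradient on its boundary
(`exists_minorant_eq`).

Conversely, no minorant exceeds a solution (`IsHRMASolution.minorant_le`). Strict convexity of `ψω`
makes the data grow linearly above some affine function of `x`. If a minorant were too large at an
interior point, mixing in a little of that function would leave room to move its slope within a
small ball; each such slope would be a subgradient at an interior minimum, so the Monge–Ampère mass
would be positive.

A minorant of `s`-slope `σ` is an affine function of `x` below `min{ψ₀, ψ₁ - σ}`, so grouping
minorants by `σ` gives the formula (`coe_eq_negLegendre_rooftopEnvelope`).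

For existence, the envelope of the minorants is a solution: its maximality forces `τ = ψ₀⋆(y) -
ψ₁⋆(y)` for each subgradient `(τ, y)`, so all subgradients lie on one graph, a null set. -/

open Filter Topology

/-! ### Supporting hyperplanes of convex functions. -/

section Support

variable {E : Type*} [NormedAddCommGroup E] [NormedSpace ℝ E] [FiniteDimensional ℝ E]

/-- A convex function on an open set has a supporting hyperplane at each point. -/
theorem ConvexOn.exists_support {Ω : Set E} (hΩ : IsOpen Ω) {u : E → ℝ} (hu : ConvexOn ℝ Ω u)
    {p : E} (hp : p ∈ Ω) : ∃ f : E →L[ℝ] ℝ, ∀ p' ∈ Ω, u p + f (p' - p) ≤ u p' := by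
  have hcont : ContinuousOn u Ω := hu.continuousOn hΩ
  have hopen : IsOpen {q : E × ℝ | q.1 ∈ Ω ∧ u q.1 < q.2} := by
    have h1 : ContinuousOn (fun q : E × ℝ => q.2 - u q.1) (Ω ×ˢ univ) :=
      continuousOn_snd.sub (hcont.comp continuousOn_fst fun q hq => hq.1)
    have h2 := h1.isOpen_inter_preimage (hΩ.prod isOpen_univ) (isOpen_Ioi (a := (0 : ℝ)))
    convert h2 using 1
    ext q
    simp
  obtain ⟨g, hg⟩ := geometric_hahn_banach_point_open (x := (p, u p)) hu.convex_strict_epigraph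
    hopen (by simp)
  have hsplit : ∀ (x : E) (t : ℝ), g (x, t) = g (x, 0) + t * g (0, 1) := fun x t => by
    have : (x, t) = (x, (0 : ℝ)) + t • ((0 : E), (1 : ℝ)) := by simp
    rw [this, map_add, map_smul, smul_eq_mul]
  -- The separating hyperplane is not vertical, because the point directly above `(p, u p)` lies in
  -- the open epigraph.
  have hβ : 0 < g (0, 1) := by
    have := hg (p, u p + 1) ⟨hp, by simp⟩
    rw [hsplit p, hsplit p (u p + 1)] at this
    linarith
  refine ⟨-(g (0, 1))⁻¹ • g.comp (ContinuousLinearMap.inl ℝ E ℝ), fun p' hp' => ?_⟩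
  have hlim : g (p, u p) ≤ g (p', u p') := by
    have h1 : Tendsto (fun t : ℝ => g (p', t)) (𝓝[>] (u p')) (𝓝 (g (p', u p'))) :=
      ((g.continuous.comp (Continuous.prodMk_right p')).tendsto _).mono_left nhdsWithin_le_nhds
    refine ge_of_tendsto h1 ?_
    filter_upwards [self_mem_nhdsWithin] with t ht
    exact (hg (p', t) ⟨hp', ht⟩).le
  rw [hsplit p, hsplit p'] at hlim
  have h3 : g (p' - p, 0) = g (p', 0) - g (p, 0) := by
    rw [← map_sub]; simp
  simp only [_root_.smul_apply, ContinuousLinearMap.comp_apply,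
    ContinuousLinearMap.inl_apply, h3, smul_eq_mul]
  rw [neg_mul, inv_mul_eq_div, ← sub_eq_add_neg, sub_le_iff_le_add, ← sub_le_iff_le_add',
    le_div_iff₀ hβ]
  linarith

end Support

/-! ### Linear growth from strict convexity. -/

section Growth

variable {E : Type*} [NormedAddCommGroup E] [InnerProductSpace ℝ E] [FiniteDimensional ℝ E]

theorem ConvexOn.exists_subgradient {f : E → ℝ} (hf : ConvexOn ℝ univ f) (x : E) :
    ∃ y : E, ∀ x', f x + inner ℝ y (x' - x) ≤ f x' := by
  have := FiniteDimensional.complete ℝ E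
  obtain ⟨g, hg⟩ := hf.exists_support isOpen_univ (mem_univ x)
  refine ⟨(InnerProductSpace.toDual ℝ E).symm g, fun x' => ?_⟩
  rw [InnerProductSpace.toDual_symm_apply]
  exact hg x' (mem_univ _)

/-- A strictly convex function grows at least linearly after subtraction of an affine function. -/
theorem StrictConvexOn.exists_affine_add_norm_le {f : E → ℝ} (hf : StrictConvexOn ℝ univ f) :
    ∃ (a : ℝ) (y : E) (ε : ℝ), 0 < ε ∧ ∀ x, a + inner ℝ y x + ε * ‖x‖ ≤ f x := by
  obtain ⟨y, hy⟩ := hf.convexOn.exists_subgradient 0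
  have hcont : Continuous f := hf.convexOn.locallyLipschitz.continuous
  simp only [sub_zero] at hy
  have hpos : ∀ x ∈ Metric.sphere (0 : E) 1, 0 < f x - f 0 - inner ℝ y x := fun x hx => by
    have hx0 : x ≠ 0 := ne_zero_of_mem_unit_sphere (⟨x, hx⟩ : Metric.sphere (0 : E) 1)
    have h1 := hf.2 (mem_univ (0 : E)) (mem_univ x) hx0.symm (one_half_pos (α := ℝ))
      (one_half_pos (α := ℝ)) (by norm_num)
    have h2 := hy ((1 / 2 : ℝ) • (0 : E) + (1 / 2 : ℝ) • x)
    simp only [smul_zero, zero_add, inner_smul_right, smul_eq_mul] at h1 h2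
    linarith
  obtain ⟨ε, hε, hle⟩ := (isCompact_sphere (0 : E) 1).exists_forall_le'
    (f := fun x => f x - f 0 - inner ℝ y x) (by fun_prop) hpos
  -- Lowering by `ε` pays for `ε * ‖x‖` in the unit ball; outside it, convexity on the segment from
  -- `0` to `x` propagates the gap `ε` found on the sphere.
  refine ⟨f 0 - ε, y, ε, hε, fun x => ?_⟩
  rcases le_total ‖x‖ 1 with hx | hx
  · nlinarith [hy x]
  · have hx0 : 0 < ‖x‖ := by linarith
    have h1 := hle (‖x‖⁻¹ • x) (by simp [norm_smul, hx0.ne'])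
    have h2 := hf.convexOn.2 (mem_univ (0 : E)) (mem_univ x)
      (show 0 ≤ 1 - ‖x‖⁻¹ by linarith [inv_le_one_of_one_le₀ hx])
      (show 0 ≤ ‖x‖⁻¹ by positivity) (by ring)
    simp only [smul_zero, zero_add, inner_smul_right, smul_eq_mul] at h1 h2
    have h3 : ε ≤ ‖x‖⁻¹ * (f x - f 0 - inner ℝ y x) := by linarith
    rw [inv_mul_eq_div, le_div_iff₀ hx0] at h3
    linarith

end Growth

/-! ### Interior minima of convex functions on the strip. -/

section Strip

variable {n : ℕ}

theorem isOpen_openStrip (n : ℕ) : IsOpen (openStrip n) := isOpen_Ioo.prod isOpen_univ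

theorem openStrip_subset_closedStrip (n : ℕ) : openStrip n ⊆ closedStrip n :=
  prod_mono Ioo_subset_Icc_self Subset.rfl

theorem convex_openStrip (n : ℕ) : Convex ℝ (openStrip n) := (convex_Ioo 0 1).prod convex_univ

theorem nhdsWithin_Ioo_neBot {e : ℝ} (he : e ∈ Icc (0 : ℝ) 1) : (𝓝[Ioo 0 1] e).NeBot := by
  rw [← mem_closure_iff_nhdsWithin_neBot, closure_Ioo (by norm_num)]
  exact he

variable {u : ℝ × EuclideanSpace ℝ (Fin n) → ℝ}

theorem tendsto_strip_boundary
    (hc : ∀ x, ContinuousOn (fun s : ℝ => u (s, x)) (Icc 0 1)) {e : ℝ} (he : e ∈ Icc (0 : ℝ) 1)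
    (x : EuclideanSpace ℝ (Fin n)) :
    Tendsto (fun δ => u (δ, x)) (𝓝[Ioo 0 1] e) (𝓝 (u (e, x))) :=
  (hc x e he).mono_left (nhdsWithin_mono _ Ioo_subset_Icc_self)

/-- Passage to the limit in the convexity inequality, at an interior limit point. -/
theorem le_of_tendsto_convexCombo (hu : ConvexOn ℝ (closedStrip n) u)
    {z w : ℝ × EuclideanSpace ℝ (Fin n)} (hz : z ∈ openStrip n) (hw : w ∈ openStrip n)
    {q : ℕ → ℝ × EuclideanSpace ℝ (Fin n)} (hq : ∀ k, q k ∈ openStrip n) {m : ℝ}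
    (hm : ∀ k, u (q k) ≤ m) {t : ℕ → ℝ} {t' : ℝ} (ht0 : ∀ᶠ k in atTop, t k ∈ Icc (0 : ℝ) 1)
    (ht : Tendsto t atTop (𝓝 t'))
    (hlim : Tendsto (fun k => (1 - t k) • z + t k • q k) atTop (𝓝 w)) :
    u w ≤ (1 - t') * u z + t' * m := by
  have hcont : ContinuousAt u w :=
    ((hu.subset (openStrip_subset_closedStrip n) (convex_openStrip n)).continuousOn
      (isOpen_openStrip n)).continuousAt ((isOpen_openStrip n).mem_nhds hw)
  refine le_of_tendsto_of_tendsto (hcont.tendsto.comp hlim)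
    (((tendsto_const_nhds.sub ht).mul_const (u z)).add (ht.mul_const m)) ?_
  filter_upwards [ht0] with k hk
  have h := hu.2 (openStrip_subset_closedStrip n hz) (openStrip_subset_closedStrip n (hq k))
    (show 0 ≤ 1 - t k by linarith [hk.2]) hk.1 (by ring)
  simp only [smul_eq_mul] at h
  have h2 := mul_le_mul_of_nonneg_left (hm k) hk.1
  simp only [Function.comp_apply]
  linarith

/-- If the boundary values are coercive, the nonpositive sublevel is bounded. -/
theorem bounded_sublevel (hu : ConvexOn ℝ (closedStrip n) u)
    (hc : ∀ x, ContinuousOn (fun s : ℝ => u (s, x)) (Icc 0 1)) {c : ℝ} (hc0 : 0 < c)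
    (h0 : ∀ x, c * ‖x‖ ≤ u (0, x)) :
    ∃ R : ℝ, ∀ q ∈ openStrip n, u q ≤ 0 → ‖q.2‖ ≤ R := by
  by_contra! hcon
  choose q hq hq0 hqn using fun k : ℕ => hcon (k + 1)
  have hpos : ∀ k, 0 < ‖(q k).2‖ := fun k => lt_trans (by positivity) (hqn k)
  have hinf : Tendsto (fun k => ‖(q k).2‖) atTop atTop :=
    tendsto_atTop_mono (fun k => by linarith [hqn k]) tendsto_natCast_atTop_atTop
  obtain ⟨v, hv, φ, hφ, hlim⟩ := (isCompact_sphere (0 : EuclideanSpace ℝ (Fin n)) 1).tendsto_subseq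
    (x := fun k => ‖(q k).2‖⁻¹ • (q k).2) (fun k => by simp [norm_smul, (hpos k).ne'])
  have hv1 : ‖v‖ = 1 := by simpa using hv
  have hinf' : Tendsto (fun k => ‖(q (φ k)).2‖⁻¹) atTop (𝓝 0) :=
    (hinf.comp hφ.tendsto_atTop).inv_tendsto_atTop
  -- `v` is a limit direction of the escaping points. Weight `T / ‖q.2‖` on them and the rest on
  -- `(δ, 0)` gives points tending to `(δ, T • v)`. Letting `δ → 0` will contradict coercivity at `s
  -- = 0`.
  have key : ∀ T : ℝ, 0 < T → ∀ δ ∈ Ioo (0 : ℝ) 1, u (δ, T • v) ≤ u (δ, 0) := fun T hT δ hδ => by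
    have ht : Tendsto (fun k => T * ‖(q (φ k)).2‖⁻¹) atTop (𝓝 0) := by
      simpa using hinf'.const_mul T
    have h := le_of_tendsto_convexCombo hu (z := (δ, 0)) (w := (δ, T • v)) (q := q ∘ φ) (m := 0)
      ⟨hδ, mem_univ _⟩ ⟨hδ, mem_univ _⟩ (fun k => hq _) (fun k => hq0 _)
      (t := fun k => T * ‖(q (φ k)).2‖⁻¹) (t' := 0) ?_ ht ?_
    · simpa using h
    · filter_upwards [ht.eventually (gt_mem_nhds zero_lt_one)] with k hk
      exact ⟨by positivity, hk.le⟩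
    · refine Tendsto.prodMk_nhds ?_ ?_
      · have h1 : Tendsto (fun k => T * ‖(q (φ k)).2‖⁻¹ * (q (φ k)).1) atTop (𝓝 0) := by
          refine squeeze_zero (fun k => ?_) (fun k => ?_) ht
          · have := (hq (φ k)).1.1
            positivity
          · exact mul_le_of_le_one_right (by positivity) (hq (φ k)).1.2.le
        have h2 := ((tendsto_const_nhds (x := (1 : ℝ))).sub ht).mul_const δ
        simpa using h2.add h1
      · have := hlim.const_smul T
        simpa [mul_smul] using this
  have hle : ∀ T : ℝ, 0 < T → c * T ≤ u (0, 0) := fun T hT => by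
    have he : (0 : ℝ) ∈ Icc (0 : ℝ) 1 := by simp
    have := nhdsWithin_Ioo_neBot he
    have h1 := le_of_tendsto_of_tendsto (tendsto_strip_boundary hc he (T • v))
      (tendsto_strip_boundary hc he 0)
      (by filter_upwards [self_mem_nhdsWithin] with δ hδ using key T hT δ hδ)
    have h2 := h0 (T • v)
    rw [norm_smul, hv1, Real.norm_of_nonneg hT.le, mul_one] at h2
    exact h2.trans h1
  have h1 := hle ((|u (0, 0)| + 1) / c) (by positivity)
  rw [mul_div_cancel₀ _ hc0.ne'] at h1
  linarith [le_abs_self (u (0, 0))]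

/-- At the boundary, a convex function continuous in `s` is lower semicontinuous. -/
theorem boundary_le_of_tendsto (hu : ConvexOn ℝ (closedStrip n) u)
    (hc : ∀ x, ContinuousOn (fun s : ℝ => u (s, x)) (Icc 0 1))
    {q : ℕ → ℝ × EuclideanSpace ℝ (Fin n)} (hq : ∀ k, q k ∈ openStrip n) {m : ℝ}
    (hm : ∀ k, u (q k) ≤ m) {e : ℝ} (he : e ∈ Icc (0 : ℝ) 1) {x : EuclideanSpace ℝ (Fin n)}
    (hlim : Tendsto q atTop (𝓝 (e, x))) : u (e, x) ≤ m := by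
  have := nhdsWithin_Ioo_neBot he
  have hmid : ∀ δ ∈ Ioo (0 : ℝ) 1, (1 - 1 / 2) * δ + 1 / 2 * e ∈ Ioo (0 : ℝ) 1 := fun δ hδ =>
    ⟨by linarith [hδ.1, he.1], by linarith [hδ.2, he.2]⟩
  -- Midpoints with `(δ, x)` converge to an interior point, where `u` is continuous. As `δ → e` this
  -- becomes `u (e, x) ≤ (u (e, x) + m) / 2`.
  have key : ∀ δ ∈ Ioo (0 : ℝ) 1,
      u ((1 - 1 / 2) * δ + 1 / 2 * e, x) ≤ (1 - 1 / 2) * u (δ, x) + 1 / 2 * m := fun δ hδ => by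
    refine le_of_tendsto_convexCombo hu (z := (δ, x)) (t := fun _ => 1 / 2)
      ⟨hδ, mem_univ _⟩ ⟨hmid δ hδ, mem_univ _⟩ hq hm
      (Eventually.of_forall fun _ => ⟨by norm_num, by norm_num⟩) tendsto_const_nhds ?_
    have h := (hlim.const_smul (1 / 2 : ℝ)).const_add ((1 - 1 / 2 : ℝ) • (δ, x))
    convert h using 2
    ext1
    · simp
    · simp only [Prod.smul_mk, Prod.mk_add_mk, ← add_smul]
      norm_num
  have hself : Tendsto (fun δ : ℝ => (1 - 1 / 2) * δ + 1 / 2 * e) (𝓝[Ioo 0 1] e)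
      (𝓝[Ioo 0 1] e) := by
    refine tendsto_nhdsWithin_iff.2 ⟨?_, ?_⟩
    · have h : Continuous fun δ : ℝ => (1 - 1 / 2) * δ + 1 / 2 * e := by fun_prop
      have h2 := h.tendsto e
      rw [show (1 - 1 / 2) * e + 1 / 2 * e = e by ring] at h2
      exact h2.mono_left nhdsWithin_le_nhds
    · filter_upwards [self_mem_nhdsWithin] with δ hδ using hmid δ hδ
  have hb := tendsto_strip_boundary hc he x
  have h := le_of_tendsto_of_tendsto (hb.comp hself) ((hb.const_mul (1 - 1 / 2)).add_const (1 / 2 * m))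
    (by filter_upwards [self_mem_nhdsWithin] with δ hδ using key δ hδ)
  linarith

/-- A convex function on the strip with coercive nonnegative boundary values that is negative
somewhere attains its minimum over the open strip. -/
theorem exists_min_openStrip (hu : ConvexOn ℝ (closedStrip n) u)
    (hc : ∀ x, ContinuousOn (fun s : ℝ => u (s, x)) (Icc 0 1)) {c : ℝ} (hc0 : 0 < c)
    (h0 : ∀ x, c * ‖x‖ ≤ u (0, x)) (h1 : ∀ x, c * ‖x‖ ≤ u (1, x))
    {p : ℝ × EuclideanSpace ℝ (Fin n)} (hp : p ∈ openStrip n) (hup : u p < 0) :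
    ∃ q ∈ openStrip n, ∀ p' ∈ openStrip n, u q ≤ u p' := by
  have hcont : ContinuousOn u (openStrip n) :=
    (hu.subset (openStrip_subset_closedStrip n) (convex_openStrip n)).continuousOn
      (isOpen_openStrip n)
  obtain ⟨R, hR⟩ := bounded_sublevel hu hc hc0 h0
  set S : Set (ℝ × EuclideanSpace ℝ (Fin n)) := {q | q ∈ openStrip n ∧ u q ≤ u p} with hS
  -- A limit of points of `S` cannot reach the boundary of the strip: there `u ≥ 0`, while the level
  -- `u p` is negative.
  have hclosed : IsClosed S := by
    refine IsSeqClosed.isClosed fun q w hq hlim => ?_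
    have he : w.1 ∈ Icc (0 : ℝ) 1 := isClosed_Icc.mem_of_tendsto
      ((continuous_fst.tendsto _).comp hlim) (Eventually.of_forall fun k =>
        Ioo_subset_Icc_self (hq k).1.1)
    have hle := boundary_le_of_tendsto hu hc (fun k => (hq k).1) (fun k => (hq k).2) he hlim
    refine ⟨⟨⟨lt_of_le_of_ne he.1 fun h => ?_, lt_of_le_of_ne he.2 fun h => ?_⟩, mem_univ _⟩, hle⟩
    · rw [← h] at hle
      have := h0 w.2
      have : 0 ≤ c * ‖w.2‖ := by positivity
      linarith
    · rw [h] at hle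
      have := h1 w.2
      have : 0 ≤ c * ‖w.2‖ := by positivity
      linarith
  have hbdd : Bornology.IsBounded S := by
    refine ((Metric.isBounded_Icc (0 : ℝ) 1).prod
      (Metric.isBounded_closedBall (x := (0 : EuclideanSpace ℝ (Fin n))) (r := R))).subset ?_
    intro q hq
    exact ⟨Ioo_subset_Icc_self hq.1.1, by simpa using hR q hq.1 (hq.2.trans hup.le)⟩
  obtain ⟨q, hq, hmin⟩ := (Metric.isCompact_of_isClosed_isBounded hclosed hbdd).exists_isMinOn
    ⟨p, hp, le_rfl⟩ (hcont.mono fun q hq => hq.1)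
  refine ⟨q, hq.1, fun p' hp' => ?_⟩
  rcases le_total (u p') (u p) with h | h
  · exact hmin ⟨hp', h⟩
  · exact hq.2.trans h

end Strip

/-! ### Affine minorants of the boundary data. -/

section Minorant

variable {n : ℕ}

/-- The affine function `(s, x) ↦ a + τ s + ⟨y, x⟩` on the strip, encoded as `(a, τ, y)`. -/
noncomputable def affineEval (l : ℝ × ℝ × EuclideanSpace ℝ (Fin n)) (p : ℝ × EuclideanSpace ℝ (Fin n)) : ℝ :=
  l.1 + l.2.1 * p.1 + inner ℝ l.2.2 p.2

/-- The affine function `l` lies below the boundary data. -/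
def IsMinorant (ψ₀ ψ₁ : EuclideanSpace ℝ (Fin n) → ℝ)
    (l : ℝ × ℝ × EuclideanSpace ℝ (Fin n)) : Prop :=
  (∀ x, affineEval l (0, x) ≤ ψ₀ x) ∧ ∀ x, affineEval l (1, x) ≤ ψ₁ x

variable {ψ₀ ψ₁ : EuclideanSpace ℝ (Fin n) → ℝ} {ψ u : ℝ × EuclideanSpace ℝ (Fin n) → ℝ}

theorem affineEval_interpolate (l : ℝ × ℝ × EuclideanSpace ℝ (Fin n)) (s : ℝ)
    (x : EuclideanSpace ℝ (Fin n)) :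
    affineEval l (s, x) = (1 - s) * affineEval l (0, x) + s * affineEval l (1, x) := by
  simp only [affineEval]; ring

theorem affineEval_combo (l : ℝ × ℝ × EuclideanSpace ℝ (Fin n))
    (p q : ℝ × EuclideanSpace ℝ (Fin n)) {a b : ℝ} (hab : a + b = 1) :
    affineEval l (a • p + b • q) = a * affineEval l p + b * affineEval l q := by
  simp only [affineEval, Prod.fst_add, Prod.snd_add, Prod.smul_fst, Prod.smul_snd, inner_add_right,
    inner_smul_right, smul_eq_mul]
  linear_combination -l.1 * hab

theorem IsMinorant.le_chord {l : ℝ × ℝ × EuclideanSpace ℝ (Fin n)} (hl : IsMinorant ψ₀ ψ₁ l)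
    {s : ℝ} (hs : s ∈ Icc (0 : ℝ) 1) (x : EuclideanSpace ℝ (Fin n)) :
    affineEval l (s, x) ≤ (1 - s) * ψ₀ x + s * ψ₁ x := by
  rw [affineEval_interpolate]
  exact add_le_add (mul_le_mul_of_nonneg_left (hl.1 x) (by linarith [hs.2]))
    (mul_le_mul_of_nonneg_left (hl.2 x) hs.1)

/-- An affine function below `ψ` on the open strip lies below its boundary values. -/
theorem isMinorant_of_le_openStrip
    (hc : ∀ x, ContinuousOn (fun s : ℝ => ψ (s, x)) (Icc 0 1))
    (h0 : ∀ x, ψ (0, x) = ψ₀ x) (h1 : ∀ x, ψ (1, x) = ψ₁ x)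
    {l : ℝ × ℝ × EuclideanSpace ℝ (Fin n)} (hl : ∀ p ∈ openStrip n, affineEval l p ≤ ψ p) :
    IsMinorant ψ₀ ψ₁ l := by
  have key : ∀ e ∈ Icc (0 : ℝ) 1, ∀ x, affineEval l (e, x) ≤ ψ (e, x) := fun e he x => by
    have := nhdsWithin_Ioo_neBot he
    have hcl : Continuous fun s : ℝ => affineEval l (s, x) := by
      simp only [affineEval]; fun_prop
    refine le_of_tendsto_of_tendsto ((hcl.tendsto e).mono_left nhdsWithin_le_nhds)
      (tendsto_strip_boundary hc he x) ?_
    filter_upwards [self_mem_nhdsWithin] with s hs using hl _ ⟨hs, mem_univ _⟩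
  exact ⟨fun x => (key 0 (by simp) x).trans_eq (h0 x), fun x => (key 1 (by simp) x).trans_eq (h1 x)⟩

/-- A supporting plane of `ψ₀` at `x`, tilted by slope `-C` in `s`, ends below `ψ₀ - C ≤ ψ₁`. It
controls the envelope near `s = 0`. -/
theorem exists_minorant_left (hψ₀ : ConvexOn ℝ univ ψ₀) {C : ℝ} (hC : ∀ x, |ψ₀ x - ψ₁ x| ≤ C)
    (x : EuclideanSpace ℝ (Fin n)) :
    ∃ l, IsMinorant ψ₀ ψ₁ l ∧ ∀ s, affineEval l (s, x) = ψ₀ x - C * s := by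
  obtain ⟨y, hy⟩ := hψ₀.exists_subgradient x
  simp only [inner_sub_right] at hy
  refine ⟨(ψ₀ x - inner ℝ y x, -C, y), ⟨fun x' => ?_, fun x' => ?_⟩, fun s => ?_⟩ <;>
    simp only [affineEval]
  · linarith [hy x']
  · linarith [hy x', (abs_le.1 (hC x')).2]
  · ring

theorem exists_minorant_right (hψ₁ : ConvexOn ℝ univ ψ₁) {C : ℝ} (hC : ∀ x, |ψ₀ x - ψ₁ x| ≤ C)
    (x : EuclideanSpace ℝ (Fin n)) :
    ∃ l, IsMinorant ψ₀ ψ₁ l ∧ ∀ s, affineEval l (s, x) = ψ₁ x - C * (1 - s) := by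
  obtain ⟨y, hy⟩ := hψ₁.exists_subgradient x
  simp only [inner_sub_right] at hy
  refine ⟨(ψ₁ x - inner ℝ y x - C, C, y), ⟨fun x' => ?_, fun x' => ?_⟩, fun s => ?_⟩ <;>
    simp only [affineEval]
  · linarith [hy x', (abs_le.1 (hC x')).1]
  · linarith [hy x']
  · ring

theorem mem_subdifferentialOn_iff {Ω : Set (ℝ × EuclideanSpace ℝ (Fin n))}
    {p q : ℝ × EuclideanSpace ℝ (Fin n)} :
    q ∈ subdifferentialOn Ω u p ↔
      ∀ p' ∈ Ω, affineEval (u p - q.1 * p.1 - inner ℝ q.2 p.2, q) p' ≤ u p' := by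
  simp only [subdifferentialOn, mem_ofPred_eq, affineEval, inner_sub_right]
  refine forall₂_congr fun p' _ => ?_
  rw [show u p - q.1 * p.1 - inner ℝ q.2 p.2 + q.1 * p'.1 + inner ℝ q.2 p'.2 =
    u p + q.1 * (p'.1 - p.1) + (inner ℝ q.2 p'.2 - inner ℝ q.2 p.2) by ring]

theorem ConvexOn.subdifferentialOn_nonempty (hu : ConvexOn ℝ (openStrip n) u)
    {p : ℝ × EuclideanSpace ℝ (Fin n)} (hp : p ∈ openStrip n) :
    (subdifferentialOn (openStrip n) u p).Nonempty := by
  obtain ⟨f, hf⟩ := hu.exists_support (isOpen_openStrip n) hp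
  refine ⟨(f (1, 0), (InnerProductSpace.toDual ℝ _).symm
    (f.comp (ContinuousLinearMap.inr ℝ ℝ (EuclideanSpace ℝ (Fin n))))), fun p' hp' => ?_⟩
  rw [InnerProductSpace.toDual_symm_apply]
  convert hf p' hp' using 1
  have h : p' - p = (p'.1 - p.1) • ((1 : ℝ), (0 : EuclideanSpace ℝ (Fin n))) +
      (0, p'.2 - p.2) := by ext1 <;> simp
  rw [h, map_add, map_smul, smul_eq_mul, add_assoc, mul_comm]
  rfl

/-- A convex function on the strip is the pointwise maximum of the affine minorants of its
boundary values. -/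
theorem exists_minorant_eq (hψ₀ : ConvexOn ℝ univ ψ₀) (hψ₁ : ConvexOn ℝ univ ψ₁)
    {C : ℝ} (hC : ∀ x, |ψ₀ x - ψ₁ x| ≤ C) (hu : ConvexOn ℝ (closedStrip n) ψ)
    (hc : ∀ x, ContinuousOn (fun s : ℝ => ψ (s, x)) (Icc 0 1))
    (h0 : ∀ x, ψ (0, x) = ψ₀ x) (h1 : ∀ x, ψ (1, x) = ψ₁ x)
    {s : ℝ} (hs : s ∈ Icc (0 : ℝ) 1) (x : EuclideanSpace ℝ (Fin n)) :
    ∃ l, IsMinorant ψ₀ ψ₁ l ∧ affineEval l (s, x) = ψ (s, x) := by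
  rcases eq_or_lt_of_le hs.1 with rfl | hs0
  · obtain ⟨l, hl, hlx⟩ := exists_minorant_left hψ₀ hC x
    exact ⟨l, hl, by rw [hlx, h0]; ring⟩
  rcases eq_or_lt_of_le hs.2 with rfl | hs1
  · obtain ⟨l, hl, hlx⟩ := exists_minorant_right hψ₁ hC x
    exact ⟨l, hl, by rw [hlx, h1]; ring⟩
  obtain ⟨q, hq⟩ := (hu.subset (openStrip_subset_closedStrip n)
    (convex_openStrip n)).subdifferentialOn_nonempty (p := (s, x)) ⟨⟨hs0, hs1⟩, mem_univ _⟩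
  exact ⟨_, isMinorant_of_le_openStrip hc h0 h1 (mem_subdifferentialOn_iff.1 hq), by
    simp only [affineEval]; ring⟩

end Minorant

/-! ### Comparison principle. -/

section Comparison

variable {n : ℕ} {ψ₀ ψ₁ : EuclideanSpace ℝ (Fin n) → ℝ}
  {ψ : ℝ × EuclideanSpace ℝ (Fin n) → ℝ}

/-- `ψ - l` is convex, coercive on the boundary and negative at `p`, so it has an interior minimum,
where the slope of `l` is a subgradient of `ψ`. -/
theorem mem_iUnion_subdifferentialOn (hu : ConvexOn ℝ (closedStrip n) ψ)
    (hc : ∀ x, ContinuousOn (fun s : ℝ => ψ (s, x)) (Icc 0 1))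
    {c : ℝ} (hc0 : 0 < c) (l : ℝ × ℝ × EuclideanSpace ℝ (Fin n))
    (h0 : ∀ x, affineEval l (0, x) + c * ‖x‖ ≤ ψ (0, x))
    (h1 : ∀ x, affineEval l (1, x) + c * ‖x‖ ≤ ψ (1, x))
    {p : ℝ × EuclideanSpace ℝ (Fin n)} (hp : p ∈ openStrip n) (hlt : ψ p < affineEval l p) :
    l.2 ∈ ⋃ q ∈ openStrip n, subdifferentialOn (openStrip n) ψ q := by
  have hconv : ConvexOn ℝ (closedStrip n) fun q => ψ q - affineEval l q := by
    refine ⟨hu.1, fun q hq r hr a b ha hb hab => ?_⟩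
    have := hu.2 hq hr ha hb hab
    simp only [affineEval_combo l q r hab, smul_eq_mul] at this ⊢
    linarith
  obtain ⟨q, hq, hmin⟩ := exists_min_openStrip hconv (fun x => (hc x).sub <| by
      simp only [affineEval]; fun_prop) hc0
    (fun x => by linarith [h0 x]) (fun x => by linarith [h1 x]) hp (by linarith)
  refine mem_iUnion₂.2 ⟨q, hq, fun p' hp' => ?_⟩
  have := hmin p' hp'
  simp only [affineEval, inner_sub_right] at this ⊢
  linarith

/-- Comparison principle: affine functions below the boundary data lie below the solution. -/
theorem IsHRMASolution.minorant_le_of_mem_openStrip (hψ : IsHRMASolution ψ₀ ψ₁ ψ)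
    {a ε : ℝ} (hε : 0 < ε) {y : EuclideanSpace ℝ (Fin n)}
    (hg₀ : ∀ x, a + inner ℝ y x + ε * ‖x‖ ≤ ψ₀ x) (hg₁ : ∀ x, a + inner ℝ y x + ε * ‖x‖ ≤ ψ₁ x)
    {l : ℝ × ℝ × EuclideanSpace ℝ (Fin n)} (hl : IsMinorant ψ₀ ψ₁ l)
    {p : ℝ × EuclideanSpace ℝ (Fin n)} (hp : p ∈ openStrip n) : affineEval l p ≤ ψ p := by
  by_contra! hlt
  obtain ⟨t, ht0, ht1, htp⟩ : ∃ t : ℝ, 0 < t ∧ t < 1 ∧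
      ψ p < (1 - t) * affineEval l p + t * affineEval (a, 0, y) p := by
    have hcont : Continuous fun t : ℝ =>
        (1 - t) * affineEval l p + t * affineEval (a, 0, y) p := by fun_prop
    have h1 : ∀ᶠ t in 𝓝[>] (0 : ℝ),
        ψ p < (1 - t) * affineEval l p + t * affineEval (a, 0, y) p :=
      ((hcont.tendsto 0).mono_left nhdsWithin_le_nhds).eventually
        (lt_mem_nhds (by simpa using hlt))
    obtain ⟨t, h2, h4, h3⟩ := (h1.and (Ioo_mem_nhdsGT (zero_lt_one (α := ℝ)))).exists
    exact ⟨t, h4, h3, h2⟩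
  set lt : ℝ × ℝ × EuclideanSpace ℝ (Fin n) := (1 - t) • l + t • (a, 0, y) with hlt_def
  have heval : ∀ q, affineEval lt q =
      (1 - t) * affineEval l q + t * affineEval (a, 0, y) q := fun q => by
    simp only [hlt_def, affineEval, Prod.fst_add, Prod.snd_add, Prod.smul_fst, Prod.smul_snd,
      inner_add_left, real_inner_smul_left, smul_eq_mul]
    ring
  set η : ℝ := (affineEval lt p - ψ p) / 2 with hη
  have hη0 : 0 < η := by rw [hη, heval]; linarith
  -- The first bound leaves half of the growth `t * ε * ‖x‖` on the boundary. The second keeps the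
  -- change at `p` at most `η / 2`, so after lowering by `η` the plane is still above `ψ p`.
  -- Lowering by `η ≥ ρ` also absorbs the change of `s`-slope at `s = 1`.
  set ρ : ℝ := min (t * ε / 2) (η / (2 * (1 + ‖p.2‖))) with hρ
  have hρ0 : 0 < ρ := by positivity
  have hρ1 : ρ ≤ t * ε / 2 := min_le_left _ _
  have hρ2 : ρ * (2 * (1 + ‖p.2‖)) ≤ η := (le_div_iff₀ (by positivity)).1 (min_le_right _ _)
  have hρ3 : ρ ≤ η := by nlinarith [norm_nonneg p.2]
  have hsub : Metric.ball lt.2 ρ ⊆ ⋃ q ∈ openStrip n, subdifferentialOn (openStrip n) ψ q := by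
    intro q hq
    rw [Metric.mem_ball, Prod.dist_eq, max_lt_iff, Real.dist_eq, dist_eq_norm] at hq
    have hin : ∀ x, |inner ℝ q.2 x - inner ℝ lt.2.2 x| ≤ ρ * ‖x‖ := fun x => by
      rw [← inner_sub_left]
      exact (abs_real_inner_le_norm _ _).trans
        (mul_le_mul_of_nonneg_right hq.2.le (norm_nonneg _))
    have hq1 := abs_lt.1 hq.1
    refine mem_iUnion_subdifferentialOn hψ.convexOn hψ.continuousOn (c := t * ε / 2)
      (by positivity) (lt.1 - η, q) (fun x => ?_) (fun x => ?_) hp ?_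
    · have e1 := heval (0, x)
      have e2 := mul_le_mul_of_nonneg_left (hl.1 x) (by linarith : 0 ≤ 1 - t)
      have e3 := mul_le_mul_of_nonneg_left (hg₀ x) ht0.le
      have e4 := mul_le_mul_of_nonneg_right hρ1 (norm_nonneg x)
      have e5 := (abs_le.1 (hin x)).2
      rw [hψ.left_endpoint]
      simp only [affineEval] at e1 e2 e3 ⊢
      linarith
    · have e1 := heval (1, x)
      have e2 := mul_le_mul_of_nonneg_left (hl.2 x) (by linarith : 0 ≤ 1 - t)
      have e3 := mul_le_mul_of_nonneg_left (hg₁ x) ht0.le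
      have e4 := mul_le_mul_of_nonneg_right hρ1 (norm_nonneg x)
      have e5 := (abs_le.1 (hin x)).2
      rw [hψ.right_endpoint]
      simp only [affineEval] at e1 e2 e3 ⊢
      linarith
    · have e5 := (abs_le.1 (hin p.2)).1
      have e6 : -ρ ≤ (q.1 - lt.2.1) * p.1 := by nlinarith [hp.1.1, hp.1.2]
      have e7 : affineEval lt p = ψ p + 2 * η := by rw [hη]; ring
      simp only [affineEval] at e7 ⊢
      linarith
  have hnull := hψ.mongeAmpere_eq_zero (openStrip n) (isOpen_openStrip n).measurableSet Subset.rfl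
  exact (Metric.measure_ball_pos volume lt.2 hρ0).ne' (measure_mono_null hsub hnull)

theorem IsHRMASolution.minorant_le (hψ : IsHRMASolution ψ₀ ψ₁ ψ)
    {a ε : ℝ} (hε : 0 < ε) {y : EuclideanSpace ℝ (Fin n)}
    (hg₀ : ∀ x, a + inner ℝ y x + ε * ‖x‖ ≤ ψ₀ x) (hg₁ : ∀ x, a + inner ℝ y x + ε * ‖x‖ ≤ ψ₁ x)
    {l : ℝ × ℝ × EuclideanSpace ℝ (Fin n)} (hl : IsMinorant ψ₀ ψ₁ l)
    {s : ℝ} (hs : s ∈ Icc (0 : ℝ) 1) (x : EuclideanSpace ℝ (Fin n)) :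
    affineEval l (s, x) ≤ ψ (s, x) := by
  rcases eq_or_lt_of_le hs.1 with rfl | hs0
  · exact (hl.1 x).trans_eq (hψ.left_endpoint x).symm
  rcases eq_or_lt_of_le hs.2 with rfl | hs1
  · exact (hl.2 x).trans_eq (hψ.right_endpoint x).symm
  exact hψ.minorant_le_of_mem_openStrip hε hg₀ hg₁ hl ⟨⟨hs0, hs1⟩, mem_univ _⟩

end Comparison

/-! ### From affine minorants to Legendre transforms. -/

section Formula

variable {n : ℕ} {ψ₀ ψ₁ : EuclideanSpace ℝ (Fin n) → ℝ}

/-- The maximum of the affine minorants at a point is given by the transform formula. -/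
theorem coe_eq_negLegendre_rooftopEnvelope {s r : ℝ} {x : EuclideanSpace ℝ (Fin n)}
    (hle : ∀ l, IsMinorant ψ₀ ψ₁ l → affineEval l (s, x) ≤ r)
    (hex : ∃ l, IsMinorant ψ₀ ψ₁ l ∧ affineEval l (s, x) = r) :
    (r : EReal) = negLegendre (fun σ => rooftopEnvelope ψ₀ ψ₁ σ x) s := by
  refine le_antisymm ?_ (iSup_le fun σ => EReal.add_le_of_le_sub (iSup_le fun y => ?_))
  · obtain ⟨⟨a, τ, y⟩, hl, rfl⟩ := hex
    have hleg : legendre (fun x => ((min (ψ₀ x) (ψ₁ x - τ) : ℝ) : EReal)) y ≤ ((-a : ℝ) : EReal) :=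
      iSup_le fun z => by
        have h0 := hl.1 z
        have h1 := hl.2 z
        simp only [affineEval] at h0 h1
        rw [← EReal.coe_sub, EReal.coe_le_coe_iff, real_inner_comm]
        have : a + inner ℝ y z ≤ min (ψ₀ z) (ψ₁ z - τ) := le_min (by linarith) (by linarith)
        linarith
    have hroof : ((inner ℝ y x + a : ℝ) : EReal) ≤ rooftopEnvelope ψ₀ ψ₁ τ x :=
      calc ((inner ℝ y x + a : ℝ) : EReal) = ((inner ℝ y x : ℝ) : EReal) - ((-a : ℝ) : EReal) := by
            rw [← EReal.coe_sub]; congr 1; ring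
        _ ≤ _ := EReal.sub_le_sub le_rfl hleg
        _ ≤ _ := le_iSup (fun y : EuclideanSpace ℝ (Fin n) => ((inner ℝ y x : ℝ) : EReal) -
            legendre (fun x => ((min (ψ₀ x) (ψ₁ x - τ) : ℝ) : EReal)) y) y
    calc ((affineEval (a, τ, y) (s, x) : ℝ) : EReal)
        = ((inner ℝ y x + a : ℝ) : EReal) + ((s * τ : ℝ) : EReal) := by
          rw [← EReal.coe_add]; congr 1; simp only [affineEval]; ring
      _ ≤ rooftopEnvelope ψ₀ ψ₁ τ x + ((s * τ : ℝ) : EReal) := add_le_add hroof le_rfl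
      _ ≤ _ := le_iSup (fun σ => rooftopEnvelope ψ₀ ψ₁ σ x + ((s * σ : ℝ) : EReal)) τ
  · have hlow : ∀ z : EuclideanSpace ℝ (Fin n),
        ((inner ℝ z y - min (ψ₀ z) (ψ₁ z - σ) : ℝ) : EReal) ≤
          legendre (fun x => ((min (ψ₀ x) (ψ₁ x - σ) : ℝ) : EReal)) y := fun z => by
      rw [EReal.coe_sub]
      exact le_iSup (fun z : EuclideanSpace ℝ (Fin n) => ((inner ℝ z y : ℝ) : EReal) -
        ((min (ψ₀ z) (ψ₁ z - σ) : ℝ) : EReal)) z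
    -- A finite value `m` makes `(-m, σ, y)` a minorant; `⊤` contributes `⊥` to the supremum, and
    -- `⊥` is excluded by `hlow`.
    generalize legendre (fun x => ((min (ψ₀ x) (ψ₁ x - σ) : ℝ) : EReal)) y = m at hlow
    induction m with
    | bot => exact absurd (hlow 0) (by simp only [le_bot_iff]; exact EReal.coe_ne_bot _)
    | top => simp
    | coe m =>
      have hm : IsMinorant ψ₀ ψ₁ (-m, σ, y) := by
        refine ⟨fun z => ?_, fun z => ?_⟩ <;>
        · have h := EReal.coe_le_coe_iff.1 (hlow z)
          rw [real_inner_comm] at h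
          simp only [affineEval]
          linarith [min_le_left (ψ₀ z) (ψ₁ z - σ), min_le_right (ψ₀ z) (ψ₁ z - σ)]
      have h := hle _ hm
      simp only [affineEval] at h
      rw [← EReal.coe_sub, ← EReal.coe_sub, EReal.coe_le_coe_iff]
      linarith

end Formula

/-! ### The envelope of minorants solves the equation. -/

section Existence

variable {n : ℕ} {ψ₀ ψ₁ : EuclideanSpace ℝ (Fin n) → ℝ}

/-- The upper envelope of the affine minorants of the boundary data. -/
noncomputable def minorantEnvelope (ψ₀ ψ₁ : EuclideanSpace ℝ (Fin n) → ℝ)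
    (p : ℝ × EuclideanSpace ℝ (Fin n)) : ℝ :=
  ⨆ l : {l : ℝ × ℝ × EuclideanSpace ℝ (Fin n) // IsMinorant ψ₀ ψ₁ l}, affineEval l.1 p

theorem le_minorantEnvelope {l : ℝ × ℝ × EuclideanSpace ℝ (Fin n)} (hl : IsMinorant ψ₀ ψ₁ l)
    {p : ℝ × EuclideanSpace ℝ (Fin n)} (hp : p ∈ closedStrip n) :
    affineEval l p ≤ minorantEnvelope ψ₀ ψ₁ p :=
  le_ciSup (f := fun l : {l : ℝ × ℝ × EuclideanSpace ℝ (Fin n) // IsMinorant ψ₀ ψ₁ l} =>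
    affineEval l.1 p) ⟨_, forall_mem_range.2 fun l => l.2.le_chord hp.1 p.2⟩ ⟨l, hl⟩

theorem minorantEnvelope_le {l₀ : ℝ × ℝ × EuclideanSpace ℝ (Fin n)} (hl₀ : IsMinorant ψ₀ ψ₁ l₀)
    {p : ℝ × EuclideanSpace ℝ (Fin n)} {r : ℝ}
    (h : ∀ l, IsMinorant ψ₀ ψ₁ l → affineEval l p ≤ r) : minorantEnvelope ψ₀ ψ₁ p ≤ r := by
  have : Nonempty {l : ℝ × ℝ × EuclideanSpace ℝ (Fin n) // IsMinorant ψ₀ ψ₁ l} := ⟨⟨l₀, hl₀⟩⟩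
  exact ciSup_le fun l => h l.1 l.2

theorem minorantEnvelope_le_chord {l₀ : ℝ × ℝ × EuclideanSpace ℝ (Fin n)}
    (hl₀ : IsMinorant ψ₀ ψ₁ l₀) {s : ℝ} (hs : s ∈ Icc (0 : ℝ) 1)
    (x : EuclideanSpace ℝ (Fin n)) :
    minorantEnvelope ψ₀ ψ₁ (s, x) ≤ (1 - s) * ψ₀ x + s * ψ₁ x :=
  minorantEnvelope_le hl₀ fun _ hl => hl.le_chord hs x

theorem convexOn_minorantEnvelope {l₀ : ℝ × ℝ × EuclideanSpace ℝ (Fin n)}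
    (hl₀ : IsMinorant ψ₀ ψ₁ l₀) : ConvexOn ℝ (closedStrip n) (minorantEnvelope ψ₀ ψ₁) := by
  refine ⟨(convex_Icc 0 1).prod convex_univ, fun p hp q hq a b ha hb hab => ?_⟩
  refine minorantEnvelope_le hl₀ fun l hl => ?_
  rw [affineEval_combo l p q hab]
  exact add_le_add (mul_le_mul_of_nonneg_left (le_minorantEnvelope hl hp) ha)
    (mul_le_mul_of_nonneg_left (le_minorantEnvelope hl hq) hb)

theorem minorantEnvelope_zero (hψ₀ : ConvexOn ℝ univ ψ₀) {C : ℝ} (hC : ∀ x, |ψ₀ x - ψ₁ x| ≤ C)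
    (x : EuclideanSpace ℝ (Fin n)) : minorantEnvelope ψ₀ ψ₁ (0, x) = ψ₀ x := by
  obtain ⟨l, hl, hlx⟩ := exists_minorant_left hψ₀ hC x
  refine le_antisymm (minorantEnvelope_le hl fun l hl => hl.1 x) ?_
  simpa [hlx] using le_minorantEnvelope hl (p := (0, x)) ⟨by simp, mem_univ _⟩

theorem minorantEnvelope_one (hψ₁ : ConvexOn ℝ univ ψ₁) {C : ℝ} (hC : ∀ x, |ψ₀ x - ψ₁ x| ≤ C)
    (x : EuclideanSpace ℝ (Fin n)) : minorantEnvelope ψ₀ ψ₁ (1, x) = ψ₁ x := by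
  obtain ⟨l, hl, hlx⟩ := exists_minorant_right hψ₁ hC x
  refine le_antisymm (minorantEnvelope_le hl fun l hl => hl.2 x) ?_
  simpa [hlx] using le_minorantEnvelope hl (p := (1, x)) ⟨by simp, mem_univ _⟩

/-- At an endpoint the envelope is squeezed between a tilted minorant and the chord; inside,
convexity suffices. -/
theorem continuousOn_minorantEnvelope (hψ₀ : ConvexOn ℝ univ ψ₀) (hψ₁ : ConvexOn ℝ univ ψ₁)
    {C : ℝ} (hC : ∀ x, |ψ₀ x - ψ₁ x| ≤ C) (x : EuclideanSpace ℝ (Fin n)) :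
    ContinuousOn (fun s : ℝ => minorantEnvelope ψ₀ ψ₁ (s, x)) (Icc 0 1) := by
  obtain ⟨l, hl, hlx⟩ := exists_minorant_left hψ₀ hC x
  obtain ⟨l', hl', hlx'⟩ := exists_minorant_right hψ₁ hC x
  have hupper : ContinuousOn (fun s : ℝ => (1 - s) * ψ₀ x + s * ψ₁ x) (Icc 0 1) := by fun_prop
  have hsqueeze : ∀ e ∈ Icc (0 : ℝ) 1, ∀ L : ℝ → ℝ, Continuous L →
      (∀ s ∈ Icc (0 : ℝ) 1, L s ≤ minorantEnvelope ψ₀ ψ₁ (s, x)) →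
      L e = (1 - e) * ψ₀ x + e * ψ₁ x →
      ContinuousWithinAt (fun s : ℝ => minorantEnvelope ψ₀ ψ₁ (s, x)) (Icc 0 1) e := by
    intro e he L hL hle hLe
    have heq : minorantEnvelope ψ₀ ψ₁ (e, x) = L e :=
      le_antisymm (hLe ▸ minorantEnvelope_le_chord hl he x) (hle e he)
    have h1 := hupper e he
    have h2 := hL.continuousWithinAt (s := Icc 0 1) (x := e)
    rw [ContinuousWithinAt, ← hLe, ← heq] at h1
    rw [ContinuousWithinAt, ← heq] at h2
    refine tendsto_of_tendsto_of_tendsto_of_le_of_le' h2 h1 ?_ ?_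
    · filter_upwards [self_mem_nhdsWithin] with s hs using hle s hs
    · filter_upwards [self_mem_nhdsWithin] with s hs using minorantEnvelope_le_chord hl hs x
  intro s hs
  rcases eq_or_lt_of_le hs.1 with rfl | hs0
  · refine hsqueeze 0 hs (fun s => ψ₀ x - C * s) (by fun_prop) (fun s hs => ?_) (by ring)
    exact (hlx s).symm.trans_le (le_minorantEnvelope hl ⟨hs, mem_univ _⟩)
  rcases eq_or_lt_of_le hs.2 with rfl | hs1
  · refine hsqueeze 1 hs (fun s => ψ₁ x - C * (1 - s)) (by fun_prop) (fun s hs => ?_) (by ring)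
    exact (hlx' s).symm.trans_le (le_minorantEnvelope hl' ⟨hs, mem_univ _⟩)
  have hcont := (((convexOn_minorantEnvelope hl).subset (openStrip_subset_closedStrip n)
    (convex_openStrip n)).continuousOn (isOpen_openStrip n)).continuousAt
    ((isOpen_openStrip n).mem_nhds (show (s, x) ∈ openStrip n from ⟨⟨hs0, hs1⟩, mem_univ _⟩))
  exact (ContinuousAt.comp (f := fun s : ℝ => (s, x)) hcont (by fun_prop)).continuousWithinAt

/-- Countable infima keep the conjugates measurable, as Fubini on the graph requires. -/
theorem ciInf_denseSeq_eq {X : Type*} [TopologicalSpace X] [TopologicalSpace.SeparableSpace X]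
    [Nonempty X] {g : X → ℝ} (hg : Continuous g) {c : ℝ} (hc : ∀ x, c ≤ g x)
    (h : ∀ η > 0, ∃ x, g x < c + η) : ⨅ k, g (TopologicalSpace.denseSeq X k) = c := by
  refine le_antisymm (le_of_forall_pos_le_add fun η hη => ?_) (le_ciInf fun k => hc _)
  obtain ⟨k, hk⟩ := (TopologicalSpace.denseRange_denseSeq X).exists_mem_open
    (isOpen_Iio.preimage hg) (h η hη)
  exact (ciInf_le ⟨c, forall_mem_range.2 fun k => hc _⟩ k).trans (le_of_lt hk)

/-- The function `y ↦ -ψ⋆(y)`, computed along a dense sequence. -/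
noncomputable def negConjugate (ψ : EuclideanSpace ℝ (Fin n) → ℝ)
    (y : EuclideanSpace ℝ (Fin n)) : ℝ :=
  ⨅ k, (ψ (TopologicalSpace.denseSeq _ k) - inner ℝ y (TopologicalSpace.denseSeq _ k))

theorem measurable_negConjugate (ψ : EuclideanSpace ℝ (Fin n) → ℝ) :
    Measurable (negConjugate ψ) :=
  Measurable.iInf fun _ => by fun_prop

/-- A subgradient `(τ, y)` of the envelope is determined by `y`. -/
theorem fst_eq_of_mem_subdifferentialOn_minorantEnvelope (hψ₀ : ConvexOn ℝ univ ψ₀)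
    (hψ₁ : ConvexOn ℝ univ ψ₁) {C : ℝ} (hC : ∀ x, |ψ₀ x - ψ₁ x| ≤ C)
    {p q : ℝ × EuclideanSpace ℝ (Fin n)} (hp : p ∈ openStrip n)
    (hq : q ∈ subdifferentialOn (openStrip n) (minorantEnvelope ψ₀ ψ₁) p) :
    q.1 = negConjugate ψ₁ q.2 - negConjugate ψ₀ q.2 := by
  set c := minorantEnvelope ψ₀ ψ₁ p - q.1 * p.1 - inner ℝ q.2 p.2 with hc
  have hmin : IsMinorant ψ₀ ψ₁ (c, q) := isMinorant_of_le_openStrip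
    (continuousOn_minorantEnvelope hψ₀ hψ₁ hC) (minorantEnvelope_zero hψ₀ hC)
    (minorantEnvelope_one hψ₁ hC) (mem_subdifferentialOn_iff.1 hq)
  have hp' := openStrip_subset_closedStrip n hp
  have h0 := hmin.1
  have h1 := hmin.2
  simp only [affineEval] at h0 h1
  -- If there were slack `η` at `s = 0`, raising the plane by `η` there and keeping it fixed at `s =
  -- 1` would give a minorant larger at `p` by `η * (1 - p.1) > 0`, against maximality of the
  -- envelope.
  have e0 : negConjugate ψ₀ q.2 = c := by
    refine ciInf_denseSeq_eq (g := fun x => ψ₀ x - inner ℝ q.2 x)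
      (hψ₀.locallyLipschitz.continuous.sub (by fun_prop)) (fun x => by linarith [h0 x])
      fun η hη => ?_
    by_contra! hcon
    have hl : IsMinorant ψ₀ ψ₁ (c + η, q.1 - η, q.2) := by
      refine ⟨fun x => ?_, fun x => ?_⟩ <;> simp only [affineEval]
      · linarith [hcon x]
      · linarith [h1 x]
    have h := le_minorantEnvelope hl hp'
    simp only [affineEval] at h
    nlinarith [hp.1.2]
  have e1 : negConjugate ψ₁ q.2 = c + q.1 := by
    refine ciInf_denseSeq_eq (g := fun x => ψ₁ x - inner ℝ q.2 x)
      (hψ₁.locallyLipschitz.continuous.sub (by fun_prop)) (fun x => by linarith [h1 x])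
      fun η hη => ?_
    by_contra! hcon
    have hl : IsMinorant ψ₀ ψ₁ (c, q.1 + η, q.2) := by
      refine ⟨fun x => ?_, fun x => ?_⟩ <;> simp only [affineEval]
      · linarith [h0 x]
      · linarith [hcon x]
    have h := le_minorantEnvelope hl hp'
    simp only [affineEval] at h
    nlinarith [hp.1.1]
  rw [e0, e1]
  ring

/-- Fubini: the slice over each `y` is the single point `g y`. -/
theorem volume_graph_eq_zero {g : EuclideanSpace ℝ (Fin n) → ℝ} (hg : Measurable g) :
    volume {q : ℝ × EuclideanSpace ℝ (Fin n) | q.1 = g q.2} = 0 := by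
  have hm : MeasurableSet {q : ℝ × EuclideanSpace ℝ (Fin n) | q.1 = g q.2} :=
    measurableSet_eq_fun measurable_fst (hg.comp measurable_snd)
  rw [Measure.volume_eq_prod, Measure.prod_apply_symm hm]
  simp [preimage]

theorem isHRMASolution_minorantEnvelope (hψ₀ : ConvexOn ℝ univ ψ₀) (hψ₁ : ConvexOn ℝ univ ψ₁)
    {C : ℝ} (hC : ∀ x, |ψ₀ x - ψ₁ x| ≤ C) :
    IsHRMASolution ψ₀ ψ₁ (minorantEnvelope ψ₀ ψ₁) where
  convexOn := by
    obtain ⟨l, hl, -⟩ := exists_minorant_left hψ₀ hC 0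
    exact convexOn_minorantEnvelope hl
  mongeAmpere_eq_zero B _ hB := by
    refine measure_mono_null (iUnion₂_subset fun p hp q hq => ?_) (volume_graph_eq_zero
      ((measurable_negConjugate ψ₁).sub (measurable_negConjugate ψ₀)))
    exact fst_eq_of_mem_subdifferentialOn_minorantEnvelope hψ₀ hψ₁ hC (hB hp) hq
  continuousOn := continuousOn_minorantEnvelope hψ₀ hψ₁ hC
  left_endpoint := minorantEnvelope_zero hψ₀ hC
  right_endpoint := minorantEnvelope_one hψ₁ hC

end Existence

theorem proposition2p3 (n : ℕ)
    (ψω ψ₀ ψ₁ : EuclideanSpace ℝ (Fin n) → ℝ)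
    (hω : StrictConvexOn ℝ Set.univ ψω)
    (h₀ : ConvexOn ℝ Set.univ ψ₀) (h₁ : ConvexOn ℝ Set.univ ψ₁)
    (hb₀ : ∃ C : ℝ, ∀ x, |ψ₀ x - ψω x| ≤ C)
    (hb₁ : ∃ C : ℝ, ∀ x, |ψ₁ x - ψω x| ≤ C) :
    (∃ ψ : ℝ × EuclideanSpace ℝ (Fin n) → ℝ, IsHRMASolution ψ₀ ψ₁ ψ ∧
      ∃ C : ℝ, ∀ s ∈ Set.Icc (0 : ℝ) 1, ∀ x, |ψ (s, x) - ψω x| ≤ C) ∧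
    (∀ ψ : ℝ × EuclideanSpace ℝ (Fin n) → ℝ, IsHRMASolution ψ₀ ψ₁ ψ →
      ∀ s ∈ Set.Icc (0 : ℝ) 1, ∀ x,
        (ψ (s, x) : EReal) = negLegendre (fun σ => rooftopEnvelope ψ₀ ψ₁ σ x) s) := by
  obtain ⟨C₀, hC₀⟩ := hb₀
  obtain ⟨C₁, hC₁⟩ := hb₁
  have hC : ∀ x, |ψ₀ x - ψ₁ x| ≤ C₀ + C₁ := fun x => by
    have e0 := abs_le.1 (hC₀ x)
    have e1 := abs_le.1 (hC₁ x)
    exact abs_le.2 ⟨by linarith, by linarith⟩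
  -- The envelope is within `C₀ + C₁` of `ψ₀`, which is within `C₀` of `ψω`.
  refine ⟨⟨_, isHRMASolution_minorantEnvelope h₀ h₁ hC, 2 * C₀ + C₁, fun s hs x => ?_⟩,
    fun ψ hψ s hs x => ?_⟩
  · obtain ⟨l, hl, hlx⟩ := exists_minorant_left h₀ hC x
    have hlow := le_minorantEnvelope hl (p := (s, x)) ⟨hs, mem_univ _⟩
    have hup := minorantEnvelope_le_chord hl hs x
    have e0 := abs_le.1 (hC₀ x)
    have e := abs_le.1 (hC x)
    have hs0 := hs.1
    have hs1 := hs.2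
    rw [hlx] at hlow
    exact abs_le.2 ⟨by nlinarith, by nlinarith⟩
  · obtain ⟨a, y, ε, hε, hg⟩ := hω.exists_affine_add_norm_le
    have hg₀ : ∀ x, a - max C₀ C₁ + inner ℝ y x + ε * ‖x‖ ≤ ψ₀ x := fun x => by
      linarith [hg x, (abs_le.1 (hC₀ x)).1, le_max_left C₀ C₁]
    have hg₁ : ∀ x, a - max C₀ C₁ + inner ℝ y x + ε * ‖x‖ ≤ ψ₁ x := fun x => by
      linarith [hg x, (abs_le.1 (hC₁ x)).1, le_max_right C₀ C₁]
    exact coe_eq_negLegendre_rooftopEnvelope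
      (fun l hl => hψ.minorant_le hε hg₀ hg₁ hl hs x)
      (exists_minorant_eq h₀ h₁ hC hψ.convexOn hψ.continuousOn hψ.left_endpoint
        hψ.right_endpoint hs x)
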